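/- Let $\mathcal H$ be a complex Hilbert space (inner product linear in the second argument), let $K$ be a bounded and boundedly invertible operator on $\mathcal H$, and let $S$ be a densely defined, closed, symmetric operator in $\mathcal H$ which is strictly positive, i.e. $\langle f,Sf\rangle\ge\varepsilon\|f\|^2$ for all $f\in\mathcal D(S)$ and some $\varepsilon>0$. An operator $T$ is called $K$-invariant if $K^*TK=T$ (including equality of domains, $\mathcal D(K^*TK)=\{f : Kf\in\mathcal D(T)\}$); assume that $S$ is $K$-invariant. A densely defined operator $A$ is called dissipative if $\operatorname{Im}\langle f,Af\rangle\ge 0$ for all $f\in\mathcal D(A)$, and maximally dissipative if moreover it has no proper dissipative extension. Let $S_F=S^*\upharpoonright_{\mathcal D(S_F)}$ and $S_K=S^*\upharpoonright_{\mathcal D(S_K)}$ be the Friedrichs and Krein--von Neumann extensions of $S$, where $\mathcal D(S_F)$ (resp. $\mathcal D(S_K)$) consists of those $f\in\mathcal D(S^*)$ for which there is a sequence $(f_n)\subset\mathcal D(S)$ with $\langle f_n-f_m,S(f_n-f_m)\rangle\to0$ as $n,m\to\infty$ and $\|f_n-f\|\to0$ (resp. $\|S^*(f_n-f)\|\to0$).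 Assume that $\ker(S^*)$ is one-dimensional and spanned by the unit vector $\eta$. Then $S_F$ is the largest and $S_K$ the smallest nonnegative self-adjoint extension of $S$ (with respect to the order $A_1\le A_2$ iff $\mathcal D(A_2^{1/2})\subseteq\mathcal D(A_1^{1/2})$ and $\|A_1^{1/2}f\|\le\|A_2^{1/2}f\|$ for $f\in\mathcal D(A_2^{1/2})$), there is $\zeta\in\mathbb C$ with $K\eta=\zeta\eta$, and the following hold. (i) If $|\zeta|\ne1$, then $S_F\ne S_K$, and $S_F$ and $S_K$ are precisely the $K$-invariant maximally dissipative extensions of $S$. (ii) If $|\zeta|=1$, then every maximally dissipative extension of $S$ is $K$-invariant. -/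

import Mathlib

open Filter Topology
open scoped LinearPMap

namespace KInv

noncomputable section

variable {H : Type*} [NormedAddCommGroup H] [InnerProductSpace ℂ H]

/-- The quadratic form `f ↦ ⟨f, T f⟩` of an operator; only its real part is recorded, which is
the whole value when `T` is symmetric. -/
def quad (T : H →ₗ.[ℂ] H) (f : T.domain) : ℝ := (inner ℂ (f : H) (T f)).re

/-- A densely defined symmetric operator. -/
structure IsSymm (S : H →ₗ.[ℂ] H) : Prop where
  dense : Dense (S.domain : Set H)
  symm : ∀ f g : S.domain, inner ℂ (S f) (g : H) = inner ℂ (f : H) (S g)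

/-- A nonnegative (densely defined) symmetric operator. -/
structure IsNonneg (S : H →ₗ.[ℂ] H) : Prop extends IsSymm S where
  nonneg : ∀ f : S.domain, 0 ≤ quad S f

/-- A strictly positive (densely defined) symmetric operator: `S ≥ ε I` for some `ε > 0`. -/
structure IsStrictlyPos (S : H →ₗ.[ℂ] H) : Prop extends IsSymm S where
  pos : ∃ ε : ℝ, 0 < ε ∧ ∀ f : S.domain, ε * ‖(f : H)‖ ^ 2 ≤ quad S f

theorem IsStrictlyPos.isNonneg {S : H →ₗ.[ℂ] H} (hS : IsStrictlyPos S) : IsNonneg S where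
  toIsSymm := hS.toIsSymm
  nonneg f := by
    obtain ⟨ε, hε, h⟩ := hS.pos
    exact le_trans (by positivity) (h f)

/-- A sequence in the domain of `T` which is Cauchy for the form of `T`:
`⟨u_n - u_m, T (u_n - u_m)⟩ → 0` as `n, m → ∞`. -/
def FormCauchy (T : H →ₗ.[ℂ] H) (u : ℕ → T.domain) : Prop :=
  Tendsto (fun p : ℕ × ℕ => quad T (u p.1 - u p.2)) atTop (𝓝 0)

theorem quad_add_le {S : H →ₗ.[ℂ] H} (hS : IsNonneg S) (f g : S.domain) :
    quad S (f + g) ≤ 2 * quad S f + 2 * quad S g := by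
  have h := hS.nonneg (f - g)
  simp only [quad, LinearPMap.map_add, LinearPMap.map_sub, Submodule.coe_add,
    AddSubgroupClass.coe_sub, inner_add_left, inner_add_right, inner_sub_left, inner_sub_right,
    Complex.add_re, Complex.sub_re] at h ⊢
  linarith

theorem quad_smul (S : H →ₗ.[ℂ] H) (c : ℂ) (f : S.domain) :
    quad S (c • f) = ‖c‖ ^ 2 * quad S f := by
  have : (starRingEnd ℂ) c * c = ((‖c‖ ^ 2 : ℝ) : ℂ) := by
    rw [mul_comm, Complex.mul_conj, Complex.normSq_eq_norm_sq]
  simp only [quad, LinearPMap.map_smul, Submodule.coe_smul, inner_smul_left, inner_smul_right]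
  rw [← mul_assoc, mul_comm c, this, Complex.re_ofReal_mul]

theorem formCauchy_zero (S : H →ₗ.[ℂ] H) : FormCauchy S (fun _ => 0) := by
  simp [FormCauchy, quad]

theorem FormCauchy.add {S : H →ₗ.[ℂ] H} (hS : IsNonneg S) {u v : ℕ → S.domain}
    (hu : FormCauchy S u) (hv : FormCauchy S v) : FormCauchy S (fun n => u n + v n) := by
  unfold FormCauchy at *
  have hb := (hu.const_mul 2).add (hv.const_mul 2)
  simp only [mul_zero, add_zero] at hb
  refine squeeze_zero (fun p => hS.nonneg _) (fun p => ?_) hb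
  rw [add_sub_add_comm]
  exact quad_add_le hS _ _

theorem FormCauchy.smul {S : H →ₗ.[ℂ] H} (c : ℂ) {u : ℕ → S.domain}
    (hu : FormCauchy S u) : FormCauchy S (fun n => c • u n) := by
  unfold FormCauchy at *
  have hb := hu.const_mul (‖c‖ ^ 2)
  rw [mul_zero] at hb
  refine hb.congr fun p => ?_
  rw [← smul_sub, quad_smul]

/-- A densely defined operator `A` is dissipative if `Im ⟨f, A f⟩ ≥ 0` on its domain. -/
def IsDissipative (A : H →ₗ.[ℂ] H) : Prop :=
  Dense (A.domain : Set H) ∧ ∀ f : A.domain, 0 ≤ (inner ℂ (f : H) (A f)).im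

/-- A dissipative operator without nontrivial dissipative extensions. -/
def IsMaxDissipative (A : H →ₗ.[ℂ] H) : Prop :=
  IsDissipative A ∧ ∀ B : H →ₗ.[ℂ] H, IsDissipative B → A ≤ B → B = A

/-- The kernel of an operator, as a subspace of the whole space. -/
def kernel (T : H →ₗ.[ℂ] H) : Submodule ℂ H := (LinearMap.ker T.toFun).map T.domain.subtype

variable [CompleteSpace H]

/-- The Friedrichs extension `S_F` of a nonnegative symmetric operator: the restriction of `S†`
to those `f` in its domain for which there are `u_n` in the domain of `S` with `u_n → f` and
`⟨u_n - u_m, S (u_n - u_m)⟩ → 0`. -/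
def friedrichs (S : H →ₗ.[ℂ] H) (hS : IsNonneg S) : H →ₗ.[ℂ] H where
  domain :=
    { carrier := {f | f ∈ S†.domain ∧ ∃ u : ℕ → S.domain,
        Tendsto (fun n => (u n : H)) atTop (𝓝 f) ∧ FormCauchy S u}
      zero_mem' := ⟨zero_mem _, fun _ => 0, by simp, formCauchy_zero S⟩
      add_mem' := by
        rintro f g ⟨hf, u, hu, hu'⟩ ⟨hg, v, hv, hv'⟩
        exact ⟨add_mem hf hg, fun n => u n + v n, by simpa using hu.add hv, hu'.add hS hv'⟩
      smul_mem' := by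
        rintro c f ⟨hf, u, hu, hu'⟩
        exact ⟨Submodule.smul_mem _ c hf, fun n => c • u n, by simpa using hu.const_smul c,
          hu'.smul c⟩ }
  toFun := S†.toFun ∘ₗ Submodule.inclusion (fun _ h => h.1)

/-- The Krein--von Neumann extension `S_K` of a nonnegative symmetric operator: the restriction
of `S†` to those `f` in its domain for which there are `u_n` in the domain of `S` with
`S† u_n = S u_n → S† f` and `⟨u_n - u_m, S (u_n - u_m)⟩ → 0`. -/
def krein (S : H →ₗ.[ℂ] H) (hS : IsNonneg S) : H →ₗ.[ℂ] H where
  domain :=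
    { carrier := {f | ∃ hf : f ∈ S†.domain, ∃ u : ℕ → S.domain,
        Tendsto (fun n => S (u n)) atTop (𝓝 (S† ⟨f, hf⟩)) ∧ FormCauchy S u}
      zero_mem' := by
        refine ⟨zero_mem _, fun _ => 0, ?_, formCauchy_zero S⟩
        have h : S† ⟨0, zero_mem _⟩ = 0 := S†.map_zero
        simp [h]
      add_mem' := by
        rintro f g ⟨hf, u, hu, hu'⟩ ⟨hg, v, hv, hv'⟩
        refine ⟨add_mem hf hg, fun n => u n + v n, ?_, hu'.add hS hv'⟩
        have h : S† ⟨f + g, add_mem hf hg⟩ = S† ⟨f, hf⟩ + S† ⟨g, hg⟩ :=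
          S†.map_add ⟨f, hf⟩ ⟨g, hg⟩
        rw [h]
        simpa only [LinearPMap.map_add] using hu.add hv
      smul_mem' := by
        rintro c f ⟨hf, u, hu, hu'⟩
        refine ⟨Submodule.smul_mem _ c hf, fun n => c • u n, ?_, hu'.smul c⟩
        have h : S† ⟨c • f, Submodule.smul_mem _ c hf⟩ = c • S† ⟨f, hf⟩ :=
          S†.map_smul c ⟨f, hf⟩
        rw [h]
        simpa only [LinearPMap.map_smul] using hu.const_smul c }
  toFun := S†.toFun ∘ₗ Submodule.inclusion (fun _ h => h.1)

/-- For a nonnegative self-adjoint operator `A`: `f` lies in the domain of `A^{1/2}`, that is, in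
the domain of the closed form of `A`, and `‖A^{1/2} f‖ ^ 2 = c`. -/
def HasFormValue (A : H →ₗ.[ℂ] H) (f : H) (c : ℝ) : Prop :=
  ∃ u : ℕ → A.domain, Tendsto (fun n => (u n : H)) atTop (𝓝 f) ∧ FormCauchy A u ∧
    Tendsto (fun n => quad A (u n)) atTop (𝓝 c)

/-- The order `A ≤ B` of nonnegative self-adjoint operators: the domain of `B^{1/2}` is contained
in that of `A^{1/2}`, and `‖A^{1/2} f‖ ≤ ‖B^{1/2} f‖` for every `f` in the former. -/
def FormLE (A B : H →ₗ.[ℂ] H) : Prop :=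
  ∀ (f : H) (c : ℝ), HasFormValue B f c → ∃ c' ≤ c, HasFormValue A f c'

/-- `A` is a nonnegative self-adjoint extension of `S`. -/
def IsNonnegSelfAdjointExt (S A : H →ₗ.[ℂ] H) : Prop :=
  S ≤ A ∧ IsSelfAdjoint A ∧ ∀ f : A.domain, 0 ≤ quad A f

/-- `A` is the largest nonnegative self-adjoint extension of `S`. -/
def IsLargestExt (S A : H →ₗ.[ℂ] H) : Prop :=
  IsNonnegSelfAdjointExt S A ∧ ∀ B, IsNonnegSelfAdjointExt S B → FormLE B A

/-- `A` is the smallest nonnegative self-adjoint extension of `S`. -/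
def IsSmallestExt (S A : H →ₗ.[ℂ] H) : Prop :=
  IsNonnegSelfAdjointExt S A ∧ ∀ B, IsNonnegSelfAdjointExt S B → FormLE A B

/-- The operator `K* T K` with its natural domain `{f | K f ∈ D(T)}`. -/
def conj (K : H →L[ℂ] H) (T : H →ₗ.[ℂ] H) : H →ₗ.[ℂ] H where
  domain := T.domain.comap (K : H →ₗ[ℂ] H)
  toFun := ((ContinuousLinearMap.adjoint K : H →L[ℂ] H) : H →ₗ[ℂ] H) ∘ₗ T.toFun ∘ₗ
    (K : H →ₗ[ℂ] H).restrict (fun _ h => h)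

/-- `T` is `K`-invariant: `K* T K = T`, including equality of the domains. -/
def IsKInvariant (K : H →L[ℂ] H) (T : H →ₗ.[ℂ] H) : Prop := conj K T = T

end

end KInv

/-! ### Forms of nonnegative operators and a variational solution of `S† w = g`. -/

namespace KInv

variable {H : Type*} [NormedAddCommGroup H] [InnerProductSpace ℂ H]

/-! Everything reduces to linear algebra in `ℂ²`. Strict positivity and closedness make the range of
`S` equal to the orthogonal complement of `η`, and a minimisation gives `w` in the form domain with
`S† w = η`. Each `f` in the domain of `S†` is then uniquely `x + a • w + b • η` with `x` in the
domain of `S`, so extensions of `S` below `S†` correspond to subspaces of pairs `(a, b)`. Green's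
identity gives `Im ⟨f, S† f⟩ = Im (conj b * a)`. Maximally dissipative extensions lie below `S†` and
correspond to lines; Friedrichs is `b = 0` and Krein is `a = 0` (`mem_friedrichs`, `mem_krein`,
`exists_mem_domain_iff`).

Invariance of `S` passes to `S†` and to the Friedrichs domain, so `K` acts diagonally: `(a, b) ↦ (c
* a, ζ * b)` with `conj ζ * c = 1` (`exists_map_coord`). Both axes are always invariant. Another
line is invariant exactly when `c = ζ`, that is, when `‖ζ‖ = 1`, and then every line is.

Extremality is a matter of forms: the domain of `S` is a form core for the Friedrichs extension, and
dropping the `η` component of a vector can only lower the form of a nonnegative self-adjoint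
extension (`quad_friedrichs_le`). -/

theorem IsSymm.im_inner_self {T : H →ₗ.[ℂ] H} (hT : IsSymm T) (f : T.domain) :
    (inner ℂ (f : H) (T f)).im = 0 := by
  have h := hT.symm f f
  rw [← inner_conj_symm] at h
  have := congrArg Complex.im h
  simp only [Complex.conj_im] at this
  linarith

theorem quad_neg (T : H →ₗ.[ℂ] H) (f : T.domain) : quad T (-f) = quad T f := by
  simp [quad, LinearPMap.map_neg]

theorem quad_sub_comm (T : H →ₗ.[ℂ] H) (f g : T.domain) : quad T (f - g) = quad T (g - f) := by
  rw [← quad_neg, neg_sub]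

theorem quad_add {T : H →ₗ.[ℂ] H} (hT : IsSymm T) (f g : T.domain) :
    quad T (f + g) = quad T f + quad T g + 2 * (inner ℂ (f : H) (T g)).re := by
  have h : (inner ℂ (g : H) (T f)).re = (inner ℂ (f : H) (T g)).re := by
    rw [← hT.symm, ← inner_conj_symm, Complex.conj_re]
  simp only [quad, LinearPMap.map_add, Submodule.coe_add, inner_add_left, inner_add_right,
    Complex.add_re, h]
  ring

/-- The Cauchy-Schwarz inequality for the form of a nonnegative operator. -/
theorem norm_inner_sq_le {T : H →ₗ.[ℂ] H} (hT : IsNonneg T) (f g : T.domain) :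
    ‖inner ℂ (f : H) (T g)‖ ^ 2 ≤ quad T f * quad T g := by
  let c : PreInnerProductSpace.Core ℂ T.domain :=
    { inner := fun f g => inner ℂ (f : H) (T g)
      conj_inner_symm := fun f g => by
        change starRingEnd ℂ (inner ℂ (g : H) (T f)) = inner ℂ (f : H) (T g)
        rw [inner_conj_symm, hT.symm]
      re_inner_nonneg := fun f => hT.nonneg f
      add_left := fun _ _ _ => inner_add_left _ _ _
      smul_left := fun _ _ _ => inner_smul_left _ _ _ }
  have h := @InnerProductSpace.Core.inner_mul_inner_self_le ℂ T.domain _ _ _ c f g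
  change ‖inner ℂ (f : H) (T g)‖ * ‖inner ℂ (g : H) (T f)‖ ≤ quad T f * quad T g at h
  rwa [← hT.symm g f, ← inner_conj_symm (T g) (f : H), RCLike.norm_conj, ← sq] at h

theorem norm_inner_le {T : H →ₗ.[ℂ] H} (hT : IsNonneg T) (f g : T.domain) :
    ‖inner ℂ (f : H) (T g)‖ ≤ √(quad T f) * √(quad T g) := by
  rw [← Real.sqrt_mul (hT.nonneg f)]
  exact Real.le_sqrt_of_sq_le (norm_inner_sq_le hT f g)

theorem sqrt_quad_add_le {T : H →ₗ.[ℂ] H} (hT : IsNonneg T) (f g : T.domain) :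
    √(quad T (f + g)) ≤ √(quad T f) + √(quad T g) := by
  rw [Real.sqrt_le_left (by positivity), quad_add hT.toIsSymm, add_sq,
    Real.sq_sqrt (hT.nonneg f), Real.sq_sqrt (hT.nonneg g)]
  have := (Complex.re_le_norm _).trans (norm_inner_le hT f g)
  linarith

theorem abs_sqrt_quad_sub_le {T : H →ₗ.[ℂ] H} (hT : IsNonneg T) (f g : T.domain) :
    |√(quad T f) - √(quad T g)| ≤ √(quad T (f - g)) := by
  rw [abs_sub_le_iff]
  have h1 := sqrt_quad_add_le hT (f - g) g
  have h2 := sqrt_quad_add_le hT (g - f) f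
  rw [sub_add_cancel] at h1 h2
  rw [quad_sub_comm T g f] at h2
  exact ⟨by linarith, by linarith⟩

theorem FormCauchy.exists_tendsto_quad {T : H →ₗ.[ℂ] H} (hT : IsNonneg T) {u : ℕ → T.domain}
    (hu : FormCauchy T u) : ∃ c, Tendsto (fun n => quad T (u n)) atTop (𝓝 c) := by
  have hc : CauchySeq fun n => √(quad T (u n)) := by
    rw [cauchySeq_iff_tendsto_dist_atTop_0]
    have h := hu.sqrt
    rw [Real.sqrt_zero] at h
    exact squeeze_zero (fun _ => dist_nonneg) (fun p => abs_sqrt_quad_sub_le hT _ _) h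
  obtain ⟨c, hc⟩ := cauchySeq_tendsto_of_complete hc
  exact ⟨c ^ 2, (hc.pow 2).congr fun n => Real.sq_sqrt (hT.nonneg _)⟩

theorem FormCauchy.of_tendsto_quad_sub {T : H →ₗ.[ℂ] H} (hT : IsNonneg T) {u v : ℕ → T.domain}
    (hu : FormCauchy T u) (hv : Tendsto (fun n => quad T (v n - u n)) atTop (𝓝 0)) :
    FormCauchy T v := by
  have h1 : Tendsto (fun p : ℕ × ℕ => quad T (v p.1 - u p.1)) atTop (𝓝 0) := by
    rw [← prod_atTop_atTop_eq]
    exact hv.comp tendsto_fst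
  have h2 : Tendsto (fun p : ℕ × ℕ => quad T (v p.2 - u p.2)) atTop (𝓝 0) := by
    rw [← prod_atTop_atTop_eq]
    exact hv.comp tendsto_snd
  -- Two applications of `quad_add_le` to a sum of three terms produce the factors 4, 4 and 2.
  have hb := ((h1.const_mul 4).add (h2.const_mul 4)).add (Tendsto.const_mul 2 hu)
  simp only [mul_zero, add_zero] at hb
  refine squeeze_zero (fun p => hT.nonneg _) (fun p => ?_) hb
  have e : v p.1 - v p.2 = ((v p.1 - u p.1) + (u p.2 - v p.2)) + (u p.1 - u p.2) := by abel
  have i1 := quad_add_le hT ((v p.1 - u p.1) + (u p.2 - v p.2)) (u p.1 - u p.2)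
  have i2 := quad_add_le hT (v p.1 - u p.1) (u p.2 - v p.2)
  rw [quad_sub_comm T (u p.2)] at i2
  rw [e]
  linarith

theorem tendsto_quad_of_tendsto_quad_sub {T : H →ₗ.[ℂ] H} (hT : IsNonneg T) {u v : ℕ → T.domain}
    {c : ℝ} (hu : Tendsto (fun n => quad T (u n)) atTop (𝓝 c))
    (hv : Tendsto (fun n => quad T (v n - u n)) atTop (𝓝 0)) :
    Tendsto (fun n => quad T (v n)) atTop (𝓝 c) := by
  have h : Tendsto (fun n => √(quad T (v n)) - √(quad T (u n))) atTop (𝓝 0) := by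
    have h := hv.sqrt
    rw [Real.sqrt_zero] at h
    exact squeeze_zero_norm (fun n => abs_sqrt_quad_sub_le hT _ _) h
  have h2 := (h.add hu.sqrt).pow 2
  have hc : 0 ≤ c := ge_of_tendsto' hu fun n => hT.nonneg _
  rw [zero_add, Real.sq_sqrt hc] at h2
  exact h2.congr fun n => by rw [sub_add_cancel, Real.sq_sqrt (hT.nonneg _)]

theorem IsSymm.inner_self {T : H →ₗ.[ℂ] H} (hT : IsSymm T) (f : T.domain) :
    inner ℂ (f : H) (T f) = quad T f :=
  Complex.ext rfl (hT.im_inner_self f)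

/-- The form of a nonnegative operator is closable: along a form-Cauchy sequence which converges
to a vector `f` of the domain of the adjoint, the form tends to `⟨f, T† f⟩`. -/
theorem FormCauchy.tendsto_ofReal_quad {T : H →ₗ.[ℂ] H} (hT : IsNonneg T) {u : ℕ → T.domain}
    (hu : FormCauchy T u) {f h : H} (hf : Tendsto (fun n => (u n : H)) atTop (𝓝 f))
    (hh : ∀ x : T.domain, inner ℂ h (x : H) = inner ℂ f (T x)) :
    Tendsto (fun n => (quad T (u n) : ℂ)) atTop (𝓝 (inner ℂ f h)) := by
  obtain ⟨c, hc⟩ := hu.exists_tendsto_quad hT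
  have h1 : Tendsto (fun p : ℕ × ℕ => quad T (u p.1)) atTop (𝓝 c) := by
    rw [← prod_atTop_atTop_eq]
    exact hc.comp tendsto_fst
  have h2 : Tendsto (fun p : ℕ × ℕ => inner ℂ ((u p.1 - u p.2 : T.domain) : H) (T (u p.1)))
      atTop (𝓝 0) := by
    have hb := hu.sqrt.mul h1.sqrt
    rw [Real.sqrt_zero, zero_mul] at hb
    exact squeeze_zero_norm (fun p => norm_inner_le hT _ _) hb
  have h3 : Tendsto (fun p : ℕ × ℕ => inner ℂ (u p.2 : H) (T (u p.1))) atTop (𝓝 (c : ℂ)) := by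
    have := ((Complex.continuous_ofReal.tendsto c).comp h1).sub h2
    rw [sub_zero] at this
    refine this.congr fun p => ?_
    simp only [Function.comp_apply, ← hT.toIsSymm.inner_self, AddSubgroupClass.coe_sub,
      inner_sub_left, sub_sub_cancel]
  have h4 : inner ℂ h f = (c : ℂ) := by
    -- The double limit of `⟨u_m, T u_n⟩` is `c`. Taking `m → ∞` first turns it into `⟨h, u_n⟩`, and
    -- then `n → ∞` gives `⟨h, f⟩`.
    refine eq_of_forall_dist_le fun δ hδ => ?_
    obtain ⟨⟨n₀, m₀⟩, hN⟩ := eventually_atTop.1 ((Metric.tendsto_nhds.1 h3) δ hδ)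
    have h5 : ∀ n ≥ n₀, dist (inner ℂ h (u n : H)) (c : ℂ) ≤ δ := fun n hn => by
      have ht : Tendsto (fun m => inner ℂ (u m : H) (T (u n))) atTop
          (𝓝 (inner ℂ h (u n : H))) := by
        rw [hh]
        exact hf.inner tendsto_const_nhds
      refine le_of_tendsto (ht.dist tendsto_const_nhds) ?_
      filter_upwards [eventually_ge_atTop m₀] with m hm
      exact (hN (n, m) ⟨hn, hm⟩).le
    have ht : Tendsto (fun n => inner ℂ h (u n : H)) atTop (𝓝 (inner ℂ h f)) :=
      tendsto_const_nhds.inner hf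
    refine le_of_tendsto (ht.dist tendsto_const_nhds) ?_
    filter_upwards [eventually_ge_atTop n₀] with n hn using h5 n hn
  rw [← inner_conj_symm, h4, Complex.conj_ofReal]
  exact (Complex.continuous_ofReal.tendsto c).comp hc

theorem FormCauchy.tendsto_quad {T : H →ₗ.[ℂ] H} (hT : IsNonneg T) {u : ℕ → T.domain}
    (hu : FormCauchy T u) {f h : H} (hf : Tendsto (fun n => (u n : H)) atTop (𝓝 f))
    (hh : ∀ x : T.domain, inner ℂ h (x : H) = inner ℂ f (T x)) :
    Tendsto (fun n => quad T (u n)) atTop (𝓝 (inner ℂ f h).re) :=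
  ((Complex.continuous_re.tendsto _).comp (hu.tendsto_ofReal_quad hT hf hh)).congr
    fun _ => Complex.ofReal_re _

/-- `⟨f, h⟩` is a limit of real form values. -/
theorem FormCauchy.im_inner_eq_zero {T : H →ₗ.[ℂ] H} (hT : IsNonneg T) {u : ℕ → T.domain}
    (hu : FormCauchy T u) {f h : H} (hf : Tendsto (fun n => (u n : H)) atTop (𝓝 f))
    (hh : ∀ x : T.domain, inner ℂ h (x : H) = inner ℂ f (T x)) : (inner ℂ f h).im = 0 :=
  tendsto_nhds_unique
    ((Complex.continuous_im.tendsto _).comp (hu.tendsto_ofReal_quad hT hf hh))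
    (tendsto_const_nhds.congr fun _ => (Complex.ofReal_im _).symm)

theorem IsStrictlyPos.tendsto_of_tendsto_quad {S : H →ₗ.[ℂ] H} (hS : IsStrictlyPos S)
    {ι : Type*} {l : Filter ι} {u : ι → S.domain}
    (hu : Tendsto (fun n => quad S (u n)) l (𝓝 0)) :
    Tendsto (fun n => (u n : H)) l (𝓝 0) := by
  obtain ⟨ε, hε, h⟩ := hS.pos
  have h1 := (hu.const_mul ε⁻¹).sqrt
  rw [mul_zero, Real.sqrt_zero] at h1
  refine squeeze_zero_norm (fun n => Real.le_sqrt_of_sq_le ?_) h1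
  rw [inv_mul_eq_div, le_div_iff₀ hε, mul_comm]
  exact h _

variable [CompleteSpace H]

theorem IsStrictlyPos.exists_tendsto {S : H →ₗ.[ℂ] H} (hS : IsStrictlyPos S)
    {u : ℕ → S.domain} (hu : FormCauchy S u) : ∃ f, Tendsto (fun n => (u n : H)) atTop (𝓝 f) := by
  refine cauchySeq_tendsto_of_complete (cauchySeq_iff_tendsto_dist_atTop_0.2 ?_)
  have h := (hS.tendsto_of_tendsto_quad hu).norm
  rw [norm_zero] at h
  exact h.congr fun p => by rw [dist_eq_norm]; rfl

/-- For a strictly positive `S`, every `g` is `S† w` for a `w` in the form domain of `S`: the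
limit of a minimising sequence of `x ↦ ⟨x, S x⟩ - 2 Re ⟨g, x⟩`. -/
theorem IsStrictlyPos.exists_friedrichs_preimage {S : H →ₗ.[ℂ] H} (hS : IsStrictlyPos S) (g : H) :
    ∃ w : H, (∀ x : S.domain, inner ℂ g (x : H) = inner ℂ w (S x)) ∧
      ∃ u : ℕ → S.domain, Tendsto (fun n => (u n : H)) atTop (𝓝 w) ∧ FormCauchy S u := by
  have hN := hS.isNonneg
  let J : S.domain → ℝ := fun x => quad S x - 2 * (inner ℂ (x : H) g).re
  have hJadd : ∀ x y : S.domain, J (x + y) = J x + quad S y +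
      2 * (inner ℂ (y : H) (S x - g)).re := fun x y => by
    have e : (inner ℂ (x : H) (S y)).re = (inner ℂ (y : H) (S x)).re := by
      rw [← hS.symm, ← inner_conj_symm, Complex.conj_re]
    simp only [J, quad_add hS.toIsSymm, e, Submodule.coe_add, inner_add_left, inner_sub_right,
      Complex.add_re, Complex.sub_re]
    ring
  have hbdd : BddBelow (Set.range J) := by
    obtain ⟨ε, hε, h⟩ := hS.pos
    refine ⟨-(‖g‖ ^ 2 / ε), ?_⟩
    rintro _ ⟨x, rfl⟩
    have h1 := h x
    have h2 := (Complex.re_le_norm _).trans (norm_inner_le_norm (𝕜 := ℂ) (x : H) g)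
    have h3 : 0 ≤ (ε * ‖(x : H)‖ - ‖g‖) ^ 2 / ε := by positivity
    have h4 : (ε * ‖(x : H)‖ - ‖g‖) ^ 2 / ε =
        ε * ‖(x : H)‖ ^ 2 - 2 * (‖(x : H)‖ * ‖g‖) + ‖g‖ ^ 2 / ε := by
      field_simp
      ring
    simp only [J]
    linarith
  set m := ⨅ x, J x with hm
  have hmJ : ∀ x, m ≤ J x := fun x => ciInf_le hbdd x
  have hex : ∀ n : ℕ, ∃ x, J x < m + 1 / ((n : ℝ) + 1) := fun n =>
    exists_lt_of_ciInf_lt (lt_add_of_pos_right _ Nat.one_div_pos_of_nat)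
  choose u hu using hex
  have hJu : Tendsto (fun n => J (u n) - m) atTop (𝓝 0) :=
    squeeze_zero (fun n => sub_nonneg.2 (hmJ _)) (fun n => by linarith [hu n])
      tendsto_one_div_add_atTop_nhds_zero_nat
  -- Parallelogram law: the value of `J` at the midpoint of `x` and `y` is `(J x + J y) / 2 - quad S
  -- (x - y) / 4`, and it is at least `m`.
  have hpar : ∀ x y : S.domain, quad S (x - y) ≤ 2 * (J x - m) + 2 * (J y - m) := fun x y => by
    have e1 := hJadd y (x - y)
    have e2 := hJadd y ((1 / 2 : ℂ) • (x - y))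
    rw [add_sub_cancel] at e1
    have h3 := hmJ (y + (1 / 2 : ℂ) • (x - y))
    have e4 : (inner ℂ (((1 / 2 : ℂ) • (x - y) : S.domain) : H) (S y - g)).re =
        1 / 2 * (inner ℂ ((x - y : S.domain) : H) (S y - g)).re := by
      rw [Submodule.coe_smul, inner_smul_left]
      have : (starRingEnd ℂ) (1 / 2 : ℂ) = ((1 / 2 : ℝ) : ℂ) := by
        rw [show (1 / 2 : ℂ) = ((1 / 2 : ℝ) : ℂ) by norm_num, Complex.conj_ofReal]
      rw [this, Complex.re_ofReal_mul]
    rw [quad_smul, e4, show ‖(1 / 2 : ℂ)‖ ^ 2 = 1 / 4 by norm_num] at e2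
    linarith
  have hC : FormCauchy S u := by
    have h1 : Tendsto (fun p : ℕ × ℕ => J (u p.1) - m) atTop (𝓝 0) := by
      rw [← prod_atTop_atTop_eq]
      exact hJu.comp tendsto_fst
    have h2 : Tendsto (fun p : ℕ × ℕ => J (u p.2) - m) atTop (𝓝 0) := by
      rw [← prod_atTop_atTop_eq]
      exact hJu.comp tendsto_snd
    have hb := (h1.const_mul 2).add (h2.const_mul 2)
    simp only [mul_zero, add_zero] at hb
    exact squeeze_zero (fun p => hN.nonneg _) (fun p => hpar _ _) hb
  obtain ⟨w, hw⟩ := hS.exists_tendsto hC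
  refine ⟨w, fun x => ?_, u, hw, hC⟩
  have hEL : ∀ n, ‖inner ℂ (x : H) (S (u n) - g)‖ ^ 2 ≤ (J (u n) - m) * (quad S x + 1) :=
    fun n => by
    set z := inner ℂ (x : H) (S (u n) - g) with hz
    have hq := hN.nonneg x
    -- Perturb the near-minimiser along `x` against the gradient `z`. The `+ 1` keeps the step size
    -- finite when `quad S x = 0`.
    have h1 := hmJ (u n + (-((quad S x + 1)⁻¹ : ℝ) * z : ℂ) • x)
    rw [hJadd, quad_smul, Submodule.coe_smul, inner_smul_left, ← hz] at h1
    have e : (starRingEnd ℂ) (-((quad S x + 1)⁻¹ : ℝ) * z : ℂ) * z =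
        ((-((quad S x + 1)⁻¹ * ‖z‖ ^ 2) : ℝ) : ℂ) := by
      rw [map_mul, mul_assoc, mul_comm (starRingEnd ℂ z), Complex.mul_conj,
        Complex.normSq_eq_norm_sq]
      simp
    rw [e, Complex.ofReal_re, norm_mul, norm_neg, Complex.norm_real, Real.norm_eq_abs,
      abs_of_nonneg (by positivity)] at h1
    have h2 : quad S x * (quad S x + 1)⁻¹ ≤ 1 := by
      rw [← div_eq_mul_inv, div_le_one (by positivity)]
      linarith
    have h3 : (quad S x + 1)⁻¹ * ‖z‖ ^ 2 ≤ J (u n) - m := by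
      have : ((quad S x + 1)⁻¹ * ‖z‖) ^ 2 * quad S x ≤ (quad S x + 1)⁻¹ * ‖z‖ ^ 2 := by
        calc _ = (quad S x * (quad S x + 1)⁻¹) * ((quad S x + 1)⁻¹ * ‖z‖ ^ 2) := by ring
          _ ≤ 1 * ((quad S x + 1)⁻¹ * ‖z‖ ^ 2) := by gcongr
          _ = _ := one_mul _
      linarith
    rwa [inv_mul_le_iff₀ (by positivity), mul_comm] at h3
  have hz0 : Tendsto (fun n => inner ℂ (x : H) (S (u n) - g)) atTop (𝓝 0) := by
    have h1 := (hJu.mul_const (quad S x + 1)).sqrt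
    rw [zero_mul, Real.sqrt_zero] at h1
    exact squeeze_zero_norm (fun n => Real.le_sqrt_of_sq_le (hEL n)) h1
  have hl : Tendsto (fun n => inner ℂ (x : H) (S (u n) - g)) atTop
      (𝓝 (inner ℂ (S x) w - inner ℂ (x : H) g)) := by
    simp only [inner_sub_right, ← hS.symm]
    exact (tendsto_const_nhds.inner hw).sub_const _
  have := sub_eq_zero.1 (tendsto_nhds_unique hl hz0)
  rw [← inner_conj_symm, ← this, inner_conj_symm]

end KInv

/-! ### Adjoints, dissipative extensions and the Friedrichs form. -/

namespace KInv

variable {H : Type*} [NormedAddCommGroup H] [InnerProductSpace ℂ H]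

theorem eq_of_le_of_le_of_domain_eq {T U R : H →ₗ.[ℂ] H} (hT : T ≤ R) (hU : U ≤ R)
    (h : T.domain = U.domain) : T = U :=
  LinearPMap.eq_of_le_of_domain_eq
    ⟨h.le, fun x y hxy => by
      rw [hT.2 (y := ⟨x, hT.1 x.2⟩) rfl, hU.2 (y := ⟨x, hT.1 x.2⟩) hxy.symm]⟩ h

theorem le_of_le_of_domain_le {S T R : H →ₗ.[ℂ] H} (hS : S ≤ R) (hT : T ≤ R)
    (h : S.domain ≤ T.domain) : S ≤ T :=
  ⟨h, fun x y hxy => by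
    rw [hS.2 (y := ⟨x, hS.1 x.2⟩) rfl, hT.2 (y := ⟨x, hS.1 x.2⟩) hxy.symm]⟩

theorem apply_inclusion {S T : H →ₗ.[ℂ] H} (h : S ≤ T) (x : S.domain) :
    T (Submodule.inclusion h.1 x) = S x :=
  (h.2 rfl).symm

theorem quad_inclusion {S T : H →ₗ.[ℂ] H} (h : S ≤ T) (x : S.domain) :
    quad T (Submodule.inclusion h.1 x) = quad S x := by
  rw [quad, apply_inclusion h]
  rfl

theorem formCauchy_inclusion {S T : H →ₗ.[ℂ] H} (h : S ≤ T) {u : ℕ → S.domain} :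
    FormCauchy T (fun n => Submodule.inclusion h.1 (u n)) ↔ FormCauchy S u := by
  simp only [FormCauchy, ← map_sub, quad_inclusion h]

theorem IsSymm.isDissipative {T : H →ₗ.[ℂ] H} (hT : IsSymm T) : IsDissipative T :=
  ⟨hT.dense, fun f => (hT.im_inner_self f).ge⟩

variable [CompleteSpace H]

theorem mem_graph_adjoint {T : H →ₗ.[ℂ] H} (hT : Dense (T.domain : Set H)) {f g : H} :
    (f, g) ∈ T†.graph ↔ ∀ x : T.domain, inner ℂ g (x : H) = inner ℂ f (T x) := by
  rw [LinearPMap.mem_graph_iff]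
  constructor
  · rintro ⟨y, rfl, rfl⟩ x
    exact LinearPMap.adjoint_isFormalAdjoint hT y x
  · intro h
    exact ⟨⟨f, LinearPMap.mem_adjoint_domain_of_exists f ⟨g, h⟩⟩, rfl,
      LinearPMap.adjoint_apply_eq hT _ h⟩

theorem IsSymm.le_adjoint {T : H →ₗ.[ℂ] H} (hT : IsSymm T) : T ≤ T† :=
  LinearPMap.IsFormalAdjoint.le_adjoint hT.dense hT.symm

theorem adjoint_le_adjoint {S T : H →ₗ.[ℂ] H} (hS : Dense (S.domain : Set H)) (h : S ≤ T) :
    T† ≤ S† := by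
  refine LinearPMap.IsFormalAdjoint.le_adjoint hS fun x y => ?_
  have := LinearPMap.adjoint_isFormalAdjoint (hS.mono h.1) y (Submodule.inclusion h.1 x)
  rw [apply_inclusion h] at this
  rw [← inner_conj_symm, ← inner_conj_symm (x : H)]
  exact congrArg _ this.symm

/-- A dissipative extension of a symmetric operator is a restriction of its adjoint. -/
theorem IsDissipative.le_adjoint {S T : H →ₗ.[ℂ] H} (hT : IsDissipative T) (hS : IsSymm S)
    (h : S ≤ T) : T ≤ S† := by
  refine LinearPMap.IsFormalAdjoint.le_adjoint hS.dense fun f g => ?_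
  set z := inner ℂ (f : H) (T g) - inner ℂ (S f) (g : H) with hz
  -- Test dissipativity on `c • f + g`. As `⟨c f, S (c f)⟩` is real, the terms quadratic in `c` drop
  -- out, and an affine function of `c` bounded below must be constant.
  have key : ∀ c : ℂ, 0 ≤ ((starRingEnd ℂ) c * z).im + (inner ℂ (g : H) (T g)).im := fun c => by
    have h1 := hT.2 (c • Submodule.inclusion h.1 f + g)
    have h2 := hS.im_inner_self (c • f)
    have e : (starRingEnd ℂ) (c * inner ℂ (g : H) (S f)) =
        (starRingEnd ℂ) c * inner ℂ (S f) (g : H) := by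
      rw [map_mul, inner_conj_symm]
    have e2 := congrArg Complex.im e
    rw [Complex.conj_im] at e2
    simp only [LinearPMap.map_add, LinearPMap.map_smul, apply_inclusion h, Submodule.coe_add,
      Submodule.coe_smul, Submodule.coe_inclusion, inner_add_left, inner_add_right,
      inner_smul_left, inner_smul_right, Complex.add_im] at h1 h2
    rw [mul_add, Complex.add_im] at h1
    rw [hz, mul_sub, Complex.sub_im]
    linarith
  have h0 : z = 0 := by
    by_contra hne
    have hp : 0 < ‖z‖ ^ 2 := by positivity
    -- This `c` makes the sum in `key` equal to `-1`.
    have h1 := key (((((inner ℂ (g : H) (T g)).im + 1) / ‖z‖ ^ 2 : ℝ) : ℂ) * Complex.I * z)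
    have e : (starRingEnd ℂ) (((((inner ℂ (g : H) (T g)).im + 1) / ‖z‖ ^ 2 : ℝ) : ℂ) *
        Complex.I * z) * z = ((-((inner ℂ (g : H) (T g)).im + 1) : ℝ) : ℂ) * Complex.I := by
      rw [map_mul, map_mul, mul_assoc, mul_comm (starRingEnd ℂ z), Complex.mul_conj,
        Complex.normSq_eq_norm_sq, Complex.conj_ofReal, Complex.conj_I]
      have hz' : (‖z‖ : ℂ) ≠ 0 := by simpa using hne
      push_cast
      field_simp
    rw [e, Complex.im_ofReal_mul, Complex.I_im] at h1
    linarith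
  exact (sub_eq_zero.1 h0).symm

theorem isSymm_of_isSelfAdjoint {A : H →ₗ.[ℂ] H} (hA : IsSelfAdjoint A) : IsSymm A where
  dense := hA.dense_domain
  symm := by
    have h := LinearPMap.adjoint_isFormalAdjoint hA.dense_domain
    rw [LinearPMap.isSelfAdjoint_def.1 hA] at h
    exact h

theorem IsSymm.isSelfAdjoint {A : H →ₗ.[ℂ] H} (hA : IsSymm A)
    (h : A†.domain ≤ A.domain) : IsSelfAdjoint A :=
  (LinearPMap.eq_of_le_of_domain_eq hA.le_adjoint (le_antisymm hA.le_adjoint.1 h)).symm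

/-- A dissipative extension of `A` is a restriction of `A† = A`. -/
theorem isMaxDissipative_of_isSelfAdjoint {A : H →ₗ.[ℂ] H} (hA : IsSelfAdjoint A) :
    IsMaxDissipative A := by
  have hs := isSymm_of_isSelfAdjoint hA
  refine ⟨hs.isDissipative, fun B hB hAB => le_antisymm ?_ hAB⟩
  have := hB.le_adjoint hs hAB
  rwa [LinearPMap.isSelfAdjoint_def.1 hA] at this

theorem friedrichs_le_adjoint {S : H →ₗ.[ℂ] H} (hS : IsNonneg S) : friedrichs S hS ≤ S† :=
  ⟨fun _ hf => hf.1, fun _ _ h => congrArg S†.toFun (Subtype.ext h)⟩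

theorem krein_le_adjoint {S : H →ₗ.[ℂ] H} (hS : IsNonneg S) : krein S hS ≤ S† :=
  ⟨fun _ hf => hf.1, fun _ _ h => congrArg S†.toFun (Subtype.ext h)⟩

theorem le_friedrichs {S : H →ₗ.[ℂ] H} (hS : IsNonneg S) : S ≤ friedrichs S hS :=
  le_of_le_of_domain_le hS.le_adjoint (friedrichs_le_adjoint hS) fun x hx =>
    ⟨hS.le_adjoint.1 hx, fun _ => ⟨x, hx⟩, tendsto_const_nhds, by simp [FormCauchy, quad]⟩

theorem le_krein {S : H →ₗ.[ℂ] H} (hS : IsNonneg S) : S ≤ krein S hS :=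
  le_of_le_of_domain_le hS.le_adjoint (krein_le_adjoint hS) fun x hx =>
    ⟨hS.le_adjoint.1 hx, fun _ => ⟨x, hx⟩, by
      rw [← hS.le_adjoint.2 (x := ⟨x, hx⟩) rfl]
      exact tendsto_const_nhds, by simp [FormCauchy, quad]⟩

/-- The domain of `S` is a core of the form of the Friedrichs extension. -/
theorem exists_tendsto_quad_friedrichs_sub {S : H →ₗ.[ℂ] H} (hS : IsNonneg S)
    (f : (friedrichs S hS).domain) :
    ∃ v : ℕ → S.domain, Tendsto (fun n => (v n : H)) atTop (𝓝 f) ∧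
      Tendsto (fun n => quad (friedrichs S hS)
        (Submodule.inclusion (le_friedrichs hS).1 (v n) - f)) atTop (𝓝 0) := by
  obtain ⟨-, u, hu, hc⟩ := f.2
  refine ⟨u, hu, ?_⟩
  -- Closability identifies the Friedrichs form of `u n - f` with a limit of forms of `u n - u m`,
  -- which the Cauchy condition makes small.
  have hlim : ∀ n, Tendsto (fun m => quad S (u n - u m)) atTop (𝓝 (quad (friedrichs S hS)
      (Submodule.inclusion (le_friedrichs hS).1 (u n) - f))) := fun n => by
    have hc' : FormCauchy S fun m => u n - u m := by
      refine hc.congr fun p => ?_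
      rw [sub_sub_sub_cancel_left, quad_sub_comm]
    refine hc'.tendsto_quad hS (f := ((u n : H) - f)) (tendsto_const_nhds.sub hu) ?_
    rw [← mem_graph_adjoint hS.dense]
    exact LinearPMap.le_graph_of_le (friedrichs_le_adjoint hS)
      ((friedrichs S hS).mem_graph (Submodule.inclusion (le_friedrichs hS).1 (u n) - f))
  rw [Metric.tendsto_nhds]
  intro δ hδ
  obtain ⟨⟨n₀, m₀⟩, hN⟩ := eventually_atTop.1 ((Metric.tendsto_nhds.1 hc) (δ / 2) (half_pos hδ))
  filter_upwards [eventually_ge_atTop n₀] with n hn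
  refine lt_of_le_of_lt (le_of_tendsto ((hlim n).dist tendsto_const_nhds) ?_) (half_lt_self hδ)
  filter_upwards [eventually_ge_atTop m₀] with m hm
  exact (hN (n, m) ⟨hn, hm⟩).le

theorem quad_friedrichs_nonneg {S : H →ₗ.[ℂ] H} (hS : IsNonneg S)
    (f : (friedrichs S hS).domain) : 0 ≤ quad (friedrichs S hS) f := by
  obtain ⟨-, u, hu, hc⟩ := f.2
  refine ge_of_tendsto' (hc.tendsto_quad hS (h := friedrichs S hS f) hu ?_) fun n => hS.nonneg _
  rw [← mem_graph_adjoint hS.dense]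
  exact LinearPMap.le_graph_of_le (friedrichs_le_adjoint hS) ((friedrichs S hS).mem_graph f)

theorem exists_seq_tendsto_quad_friedrichs_sub {S : H →ₗ.[ℂ] H} (hS : IsNonneg S)
    (g : ℕ → (friedrichs S hS).domain) :
    ∃ v : ℕ → S.domain, Tendsto (fun n => (v n : H) - g n) atTop (𝓝 0) ∧
      Tendsto (fun n => quad (friedrichs S hS)
        (Submodule.inclusion (le_friedrichs hS).1 (v n) - g n)) atTop (𝓝 0) := by
  have hex : ∀ n : ℕ, ∃ v : S.domain, ‖(v : H) - g n‖ < 1 / ((n : ℝ) + 1) ∧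
      quad (friedrichs S hS) (Submodule.inclusion (le_friedrichs hS).1 v - g n) <
        1 / ((n : ℝ) + 1) := fun n => by
    obtain ⟨v, h1, h2⟩ := exists_tendsto_quad_friedrichs_sub hS (g n)
    have hp : 0 < 1 / ((n : ℝ) + 1) := Nat.one_div_pos_of_nat
    have h3 := (tendsto_iff_norm_sub_tendsto_zero.1 h1).eventually_lt_const hp
    obtain ⟨k, hk⟩ := (h3.and (h2.eventually_lt_const hp)).exists
    exact ⟨v k, hk⟩
  choose v hv using hex
  exact ⟨v, squeeze_zero_norm (fun n => (hv n).1.le) tendsto_one_div_add_atTop_nhds_zero_nat,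
    squeeze_zero (fun n => quad_friedrichs_nonneg hS _) (fun n => (hv n).2.le)
      tendsto_one_div_add_atTop_nhds_zero_nat⟩

/-- The Friedrichs extension has the largest form among the extensions of `S`. -/
theorem formLE_friedrichs {S B : H →ₗ.[ℂ] H} (hS : IsNonneg S)
    (hF : IsNonneg (friedrichs S hS)) (hB : S ≤ B) : FormLE B (friedrichs S hS) := by
  rintro f c ⟨u, hu, hc, hq⟩
  obtain ⟨v, h1, h2⟩ := exists_seq_tendsto_quad_friedrichs_sub hS u
  refine ⟨c, le_rfl, fun n => Submodule.inclusion hB.1 (v n), ?_,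
    (formCauchy_inclusion hB).2 ((formCauchy_inclusion (le_friedrichs hS)).1
      (hc.of_tendsto_quad_sub hF h2)), ?_⟩
  · simpa using h1.add hu
  · have := tendsto_quad_of_tendsto_quad_sub hF hq h2
    simpa only [quad_inclusion hB, quad_inclusion (le_friedrichs hS)] using this

end KInv

/-! ### Boundary values and the extremal extensions. -/

namespace KInv

variable {H : Type*} [NormedAddCommGroup H] [InnerProductSpace ℂ H]

theorem IsStrictlyPos.exists_antilipschitz {S : H →ₗ.[ℂ] H} (hS : IsStrictlyPos S) :
    ∃ ε : ℝ, 0 < ε ∧ ∀ x : S.domain, ε * ‖(x : H)‖ ≤ ‖S x‖ := by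
  obtain ⟨ε, hε, h⟩ := hS.pos
  refine ⟨ε, hε, fun x => ?_⟩
  rcases (norm_nonneg (x : H)).eq_or_lt with h0 | h0
  · rw [← h0, mul_zero]
    exact norm_nonneg _
  · have h1 := (h x).trans ((Complex.re_le_norm _).trans (norm_inner_le_norm (x : H) (S x)))
    rw [sq, ← mul_assoc, mul_comm ‖(x : H)‖] at h1
    exact le_of_mul_le_mul_right h1 h0

theorem IsStrictlyPos.eq_zero_of_apply_eq_zero {S : H →ₗ.[ℂ] H} (hS : IsStrictlyPos S)
    {x : S.domain} (hx : S x = 0) : x = 0 := by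
  obtain ⟨ε, hε, h⟩ := hS.exists_antilipschitz
  have h1 := h x
  rw [hx, norm_zero] at h1
  have h2 : ‖(x : H)‖ ≤ 0 := nonpos_of_mul_nonpos_right h1 hε
  exact Subtype.ext (norm_le_zero_iff.1 h2)

variable [CompleteSpace H]

/-- `S` is bounded below, so preimages of a convergent sequence are Cauchy, and the closed graph
contains the limit. -/
theorem IsStrictlyPos.isClosed_range {S : H →ₗ.[ℂ] H} (hS : IsStrictlyPos S)
    (hc : S.IsClosed) : IsClosed (LinearMap.range S.toFun : Set H) := by
  obtain ⟨ε, hε, h⟩ := hS.exists_antilipschitz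
  refine isClosed_of_closure_subset fun g hg => ?_
  obtain ⟨y, hy, hlim⟩ := mem_closure_iff_seq_limit.1 hg
  choose x hx using hy
  have hx' : ∀ n, S (x n) = y n := hx
  have hxc : CauchySeq fun n => (x n : H) := by
    rw [cauchySeq_iff_tendsto_dist_atTop_0]
    have hb := (cauchySeq_iff_tendsto_dist_atTop_0.1 hlim.cauchySeq).const_mul ε⁻¹
    rw [mul_zero] at hb
    refine squeeze_zero (fun _ => dist_nonneg) (fun p => ?_) hb
    have h1 := h (x p.1 - x p.2)
    rw [LinearPMap.map_sub, hx', hx'] at h1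
    rw [dist_eq_norm, dist_eq_norm, le_inv_mul_iff₀ hε]
    exact h1
  obtain ⟨f, hf⟩ := cauchySeq_tendsto_of_complete hxc
  have hmem : (f, g) ∈ S.graph := by
    refine IsClosed.mem_of_tendsto hc (hf.prodMk_nhds hlim) (Eventually.of_forall fun n => ?_)
    rw [← hx' n]
    exact S.mem_graph (x n)
  obtain ⟨z, -, hz⟩ := S.mem_graph_iff.1 hmem
  exact ⟨z, hz⟩

theorem mem_kernel_adjoint {S : H →ₗ.[ℂ] H} (hS : Dense (S.domain : Set H)) {f : H} :
    f ∈ kernel S† ↔ ∀ x : S.domain, inner ℂ f (S x) = 0 := by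
  have h : f ∈ kernel S† ↔ (f, (0 : H)) ∈ S†.graph := by
    rw [kernel, Submodule.mem_map, LinearPMap.mem_graph_iff]
    exact ⟨fun ⟨y, h1, h2⟩ => ⟨y, h2, h1⟩, fun ⟨y, h2, h1⟩ => ⟨y, h1, h2⟩⟩
  rw [h, mem_graph_adjoint hS]
  simp only [inner_zero_left, eq_comm]

/-- The situation of a strictly positive `S` whose adjoint has the kernel `span {η}`, together
with a vector `w` of the form domain of `S` such that `S† w = η`. -/
structure DefectBasis (S : H →ₗ.[ℂ] H) (η w : H) : Prop where
  pos : IsStrictlyPos S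
  norm_eq : ‖η‖ = 1
  inner_eta : ∀ x : S.domain, inner ℂ η (S x) = 0
  inner_w : ∀ x : S.domain, inner ℂ w (S x) = inner ℂ η (x : H)
  eq_add : ∀ f g, (f, g) ∈ S†.graph →
    ∃ (x : S.domain) (a b : ℂ), f = x + a • w + b • η ∧ g = S x + a • η
  approx : ∃ u : ℕ → S.domain, Tendsto (fun n => (u n : H)) atTop (𝓝 w) ∧ FormCauchy S u

theorem exists_defectBasis {S : H →ₗ.[ℂ] H} (hS : IsStrictlyPos S) (hc : S.IsClosed) {η : H}
    (hη : ‖η‖ = 1) (hker : kernel S† = Submodule.span ℂ {η}) : ∃ w, DefectBasis S η w := by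
  obtain ⟨w, hw, hu⟩ := hS.exists_friedrichs_preimage η
  have hηη : inner ℂ η η = (1 : ℂ) := by
    rw [inner_self_eq_norm_sq_to_K, hη]
    simp
  have hηS : ∀ x : S.domain, inner ℂ η (S x) = 0 := by
    rw [← mem_kernel_adjoint hS.dense, hker]
    exact Submodule.mem_span_singleton_self η
  refine ⟨w, hS, hη, hηS, fun x => (hw x).symm, fun f g hfg => ?_, hu⟩
  have : CompleteSpace (LinearMap.range S.toFun) :=
    (hS.isClosed_range hc).completeSpace_coe
  -- The orthogonal complement of the range of `S` is `ker S† = span {η}`, so removing the `η`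
  -- component of `g` lands in the closed range.
  have hmem : g - inner ℂ η g • η ∈ LinearMap.range S.toFun := by
    rw [← Submodule.orthogonal_orthogonal (LinearMap.range S.toFun), Submodule.mem_orthogonal]
    intro v hv
    have hv' : v ∈ kernel S† := by
      rw [mem_kernel_adjoint hS.dense]
      intro x
      exact (Submodule.mem_orthogonal' _ _).1 hv _ ⟨x, rfl⟩
    rw [hker, Submodule.mem_span_singleton] at hv'
    obtain ⟨b, rfl⟩ := hv'
    rw [inner_smul_left, inner_sub_right, inner_smul_right, hηη, mul_one, sub_self, mul_zero]
  obtain ⟨x, hx⟩ := hmem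
  have hx' : S x = g - inner ℂ η g • η := hx
  -- `S†` sends both `f` and `x + ⟨η, g⟩ • w` to `g`.
  have hk : f - x - inner ℂ η g • w ∈ kernel S† := by
    rw [mem_kernel_adjoint hS.dense]
    intro y
    rw [inner_sub_left, inner_sub_left, inner_smul_left, ← hw, ← (mem_graph_adjoint hS.dense).1 hfg,
      ← hS.symm, hx', inner_sub_left, inner_smul_left]
    ring
  rw [hker, Submodule.mem_span_singleton] at hk
  obtain ⟨b, hb⟩ := hk
  refine ⟨x, inner ℂ η g, b, ?_, ?_⟩
  · rw [hb]
    module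
  · rw [hx']
    module

/-- `f` has the boundary values `a` and `b`. -/
def HasCoord (S : H →ₗ.[ℂ] H) (η w f : H) (a b : ℂ) : Prop :=
  ∃ x : S.domain, f = x + a • w + b • η

namespace DefectBasis

variable {S : H →ₗ.[ℂ] H} {η w : H} (h : DefectBasis S η w)

include h

theorem inner_eta_eta : inner ℂ η η = (1 : ℂ) := by
  rw [inner_self_eq_norm_sq_to_K, h.norm_eq]
  simp

theorem eta_ne_zero : η ≠ 0 := by
  rintro rfl
  simpa using h.norm_eq

theorem mem_graph (x : S.domain) (a b : ℂ) :
    ((x : H) + a • w + b • η, S x + a • η) ∈ S†.graph := by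
  rw [mem_graph_adjoint h.pos.dense]
  intro y
  simp only [inner_add_left, inner_smul_left, h.inner_w, h.inner_eta, h.pos.symm x y, mul_zero,
    add_zero]

theorem mem_adjoint_domain {f : H} : f ∈ S†.domain ↔ ∃ a b, HasCoord S η w f a b := by
  constructor
  · intro hf
    obtain ⟨x, a, b, h1, -⟩ := h.eq_add _ _ (S†.mem_graph ⟨f, hf⟩)
    exact ⟨a, b, x, h1⟩
  · rintro ⟨a, b, x, rfl⟩
    exact LinearPMap.mem_domain_of_mem_graph (h.mem_graph x a b)

/-- Applying `S†` to the decomposition of `0` and pairing with `η` isolates `a`; injectivity of `S`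
then removes `x`. -/
theorem hasCoord_zero {a b : ℂ} (h0 : HasCoord S η w 0 a b) : a = 0 ∧ b = 0 := by
  obtain ⟨x, hx⟩ := h0
  have hg := h.mem_graph x a b
  rw [← hx] at hg
  have h1 : S x + a • η = 0 := S†.graph_fst_eq_zero_snd hg rfl
  have ha : a = 0 := by
    have := congrArg (inner ℂ η) h1
    rwa [inner_add_right, h.inner_eta, inner_smul_right, h.inner_eta_eta, zero_add, mul_one,
      inner_zero_right] at this
  subst ha
  rw [zero_smul, add_zero] at h1
  rw [h.pos.eq_zero_of_apply_eq_zero h1, zero_smul, Submodule.coe_zero, zero_add, zero_add] at hx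
  exact ⟨rfl, (smul_eq_zero.1 hx.symm).resolve_right h.eta_ne_zero⟩

theorem coord_unique {f : H} {a b a' b' : ℂ} (h1 : HasCoord S η w f a b)
    (h2 : HasCoord S η w f a' b') : a = a' ∧ b = b' := by
  obtain ⟨x, hx⟩ := h1
  obtain ⟨y, hy⟩ := h2
  have h0 : HasCoord S η w 0 (a - a') (b - b') := by
    refine ⟨x - y, ?_⟩
    rw [← sub_self f]
    nth_rewrite 1 [hx]
    rw [hy, AddSubgroupClass.coe_sub]
    module
  have := h.hasCoord_zero h0
  exact ⟨sub_eq_zero.1 this.1, sub_eq_zero.1 this.2⟩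

theorem im_inner_w_eta : (inner ℂ w η).im = 0 := by
  obtain ⟨u, hu, hc⟩ := h.approx
  exact hc.im_inner_eq_zero h.pos.isNonneg hu fun x => (h.inner_w x).symm

/-- Green's identity. -/
theorem green (x y : S.domain) (a b a' b' : ℂ) :
    inner ℂ ((x : H) + a • w + b • η) (S y + a' • η) =
      inner ℂ (S x + a • η) ((y : H) + a' • w + b' • η) +
        ((starRingEnd ℂ) b * a' - (starRingEnd ℂ) a * b') := by
  have e1 : inner ℂ (S x) w = inner ℂ (x : H) η := by
    rw [← inner_conj_symm, h.inner_w, inner_conj_symm]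
  have e2 : inner ℂ (S x) η = (0 : ℂ) := by
    rw [← inner_conj_symm, h.inner_eta, map_zero]
  have e3 : inner ℂ η w = inner ℂ w η := by
    rw [← inner_conj_symm]
    exact Complex.conj_eq_iff_im.2 h.im_inner_w_eta
  simp only [inner_add_left, inner_add_right, inner_smul_left, inner_smul_right, e1, e2, e3,
    h.inner_w, h.inner_eta, h.pos.symm x y, h.inner_eta_eta]
  ring

/-- Dissipativity of an extension below `S†` is thus a condition on boundary values alone. -/
theorem im_inner (x : S.domain) (a b : ℂ) :
    (inner ℂ ((x : H) + a • w + b • η) (S x + a • η)).im = ((starRingEnd ℂ) b * a).im := by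
  have e := congrArg Complex.im (h.green x x a b a b)
  rw [← inner_conj_symm (S x + a • η)] at e
  simp only [Complex.add_im, Complex.sub_im, Complex.conj_im, Complex.mul_im, Complex.conj_re] at e
  simp only [Complex.mul_im, Complex.conj_re, Complex.conj_im]
  linarith

theorem apply_eq {T : H →ₗ.[ℂ] H} (hT : T ≤ S†) {f : T.domain} {x : S.domain} {a b : ℂ}
    (hf : (f : H) = x + a • w + b • η) : T f = S x + a • η := by
  have h1 := LinearPMap.le_graph_of_le hT (T.mem_graph f)
  rw [hf] at h1
  exact LinearPMap.mem_graph_snd_inj _ h1 (h.mem_graph x a b) rfl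

/-- Since `S† η = 0`, the forms of an approximating sequence would tend to `⟨η, 0⟩ = 0`, and strict
positivity would force `η = 0`. -/
theorem eta_notMem_friedrichs (hS : IsNonneg S) : η ∉ (friedrichs S hS).domain := by
  rintro ⟨-, u, hu, hc⟩
  have h1 := hc.tendsto_quad hS hu (h := 0) fun x => by rw [inner_zero_left, h.inner_eta]
  rw [inner_zero_right, Complex.zero_re] at h1
  exact h.eta_ne_zero (tendsto_nhds_unique hu (h.pos.tendsto_of_tendsto_quad h1))

theorem w_mem_friedrichs (hS : IsNonneg S) : w ∈ (friedrichs S hS).domain :=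
  ⟨h.mem_adjoint_domain.2 ⟨1, 0, 0, by simp⟩, h.approx⟩

theorem mem_friedrichs (hS : IsNonneg S) {f : H} :
    f ∈ (friedrichs S hS).domain ↔ ∃ a, HasCoord S η w f a 0 := by
  constructor
  · intro hf
    obtain ⟨a, b, x, hx⟩ := h.mem_adjoint_domain.1 ((friedrichs_le_adjoint hS).1 hf)
    refine ⟨a, x, ?_⟩
    have hb : b • η ∈ (friedrichs S hS).domain := by
      have : b • η = f - (x : H) - a • w := by
        rw [hx]
        module
      rw [this]
      exact sub_mem (sub_mem hf ((le_friedrichs hS).1 x.2))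
        (Submodule.smul_mem _ _ (h.w_mem_friedrichs hS))
    have hb0 : b = 0 := by
      by_contra hne
      exact h.eta_notMem_friedrichs hS ((Submodule.smul_mem_iff _ hne).1 hb)
    rwa [hb0] at hx
  · rintro ⟨a, x, rfl⟩
    rw [zero_smul, add_zero]
    exact add_mem ((le_friedrichs hS).1 x.2) (Submodule.smul_mem _ _ (h.w_mem_friedrichs hS))

theorem eta_mem_krein (hS : IsNonneg S) : η ∈ (krein S hS).domain := by
  have hg : (η, (0 : H)) ∈ S†.graph := by
    simpa using h.mem_graph 0 0 1
  obtain ⟨⟨y, hy⟩, h1, h2⟩ := LinearPMap.mem_graph_iff _ |>.1 hg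
  change y = η at h1
  subst h1
  refine ⟨hy, fun _ => 0, ?_, formCauchy_zero S⟩
  rw [h2]
  simp

theorem mem_krein (hS : IsNonneg S) {f : H} :
    f ∈ (krein S hS).domain ↔ ∃ b, HasCoord S η w f 0 b := by
  constructor
  · rintro ⟨hf, u, hu, -⟩
    obtain ⟨a, b, x, hx⟩ := h.mem_adjoint_domain.1 hf
    have e : S† ⟨f, hf⟩ = S x + a • η := h.apply_eq le_rfl hx
    -- Each `S (u n)` is orthogonal to `η`, hence so is the limit, whose pairing with `η` is `a`.
    have h1 : Tendsto (fun n => inner ℂ η (S (u n))) atTop (𝓝 (inner ℂ η (S† ⟨f, hf⟩))) :=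
      tendsto_const_nhds.inner hu
    simp only [h.inner_eta] at h1
    have h2 := tendsto_nhds_unique h1 tendsto_const_nhds
    rw [e, inner_add_right, h.inner_eta, inner_smul_right, h.inner_eta_eta, zero_add,
      mul_one] at h2
    rw [h2] at hx
    exact ⟨b, x, hx⟩
  · rintro ⟨b, x, rfl⟩
    rw [zero_smul, add_zero]
    exact add_mem ((le_krein hS).1 x.2) (Submodule.smul_mem _ _ (h.eta_mem_krein hS))

theorem isSelfAdjoint_friedrichs (hS : IsNonneg S) : IsSelfAdjoint (friedrichs S hS) := by
  have hle := friedrichs_le_adjoint hS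
  have hsymm : IsSymm (friedrichs S hS) := by
    refine ⟨hS.dense.mono (le_friedrichs hS).1, fun f g => ?_⟩
    obtain ⟨a, x, hx⟩ := (h.mem_friedrichs hS).1 f.2
    obtain ⟨a', y, hy⟩ := (h.mem_friedrichs hS).1 g.2
    rw [h.apply_eq hle hx, h.apply_eq hle hy, hx, hy, h.green x y a 0 a' 0]
    simp
  refine hsymm.isSelfAdjoint fun f hf => ?_
  have hle' := adjoint_le_adjoint hS.dense (le_friedrichs hS)
  obtain ⟨a, b, x, hx⟩ := h.mem_adjoint_domain.1 (hle'.1 hf)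
  -- Against `w`, with boundary values `(1, 0)`, the boundary term of Green's identity is `conj b`,
  -- which must vanish.
  have hw := LinearPMap.adjoint_isFormalAdjoint hsymm.dense ⟨f, hf⟩ ⟨w, h.w_mem_friedrichs hS⟩
  have hx' : ((⟨f, hf⟩ : (friedrichs S hS)†.domain) : H) = x + a • w + b • η := hx
  have e : friedrichs S hS ⟨w, h.w_mem_friedrichs hS⟩ = S 0 + (1 : ℂ) • η :=
    h.apply_eq hle (b := 0) (by simp)
  have hg := h.green x 0 a b 1 0
  rw [h.apply_eq hle' hx', hx', e, hg] at hw
  simp only [Submodule.coe_zero, zero_add, one_smul, zero_smul, add_zero, mul_one, mul_zero,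
    sub_zero, left_eq_add, map_eq_zero] at hw
  rw [hw] at hx
  exact (h.mem_friedrichs hS).2 ⟨a, x, hx⟩

theorem isSelfAdjoint_krein (hS : IsNonneg S) : IsSelfAdjoint (krein S hS) := by
  have hle := krein_le_adjoint hS
  have hsymm : IsSymm (krein S hS) := by
    refine ⟨hS.dense.mono (le_krein hS).1, fun f g => ?_⟩
    obtain ⟨b, x, hx⟩ := (h.mem_krein hS).1 f.2
    obtain ⟨b', y, hy⟩ := (h.mem_krein hS).1 g.2
    rw [h.apply_eq hle hx, h.apply_eq hle hy, hx, hy, h.green x y 0 b 0 b']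
    simp
  refine hsymm.isSelfAdjoint fun f hf => ?_
  have hle' := adjoint_le_adjoint hS.dense (le_krein hS)
  obtain ⟨a, b, x, hx⟩ := h.mem_adjoint_domain.1 (hle'.1 hf)
  -- Against `η`, with boundary values `(0, 1)`, the boundary term is `-conj a`.
  have hw := LinearPMap.adjoint_isFormalAdjoint hsymm.dense ⟨f, hf⟩ ⟨η, h.eta_mem_krein hS⟩
  have hx' : ((⟨f, hf⟩ : (krein S hS)†.domain) : H) = x + a • w + b • η := hx
  have e : krein S hS ⟨η, h.eta_mem_krein hS⟩ = S 0 + (0 : ℂ) • η :=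
    h.apply_eq hle (b := 1) (by simp)
  have hg := h.green x 0 a b 0 1
  rw [h.apply_eq hle' hx', hx', e, hg] at hw
  simp only [Submodule.coe_zero, zero_add, one_smul, zero_smul, add_zero, mul_one, mul_zero,
    zero_sub, left_eq_add, map_eq_zero, neg_eq_zero] at hw
  rw [hw] at hx
  exact (h.mem_krein hS).2 ⟨b, x, hx⟩

theorem quad_krein (hS : IsNonneg S) (f : (krein S hS).domain) {x : S.domain} {b : ℂ}
    (hx : (f : H) = x + b • η) : quad (krein S hS) f = quad S x := by
  have e : krein S hS f = S x + (0 : ℂ) • η :=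
    h.apply_eq (krein_le_adjoint hS) (b := b) (by rw [hx, zero_smul, add_zero])
  rw [quad, e, hx, zero_smul, add_zero, inner_add_left, inner_smul_left, h.inner_eta, mul_zero,
    add_zero, quad]

theorem isNonneg_friedrichs (hS : IsNonneg S) : IsNonneg (friedrichs S hS) :=
  ⟨isSymm_of_isSelfAdjoint (h.isSelfAdjoint_friedrichs hS), quad_friedrichs_nonneg hS⟩

theorem quad_krein_nonneg (hS : IsNonneg S) (f : (krein S hS).domain) :
    0 ≤ quad (krein S hS) f := by
  obtain ⟨b, x, hx⟩ := (h.mem_krein hS).1 f.2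
  rw [zero_smul, add_zero] at hx
  rw [h.quad_krein hS f hx]
  exact hS.nonneg x

theorem isLargestExt_friedrichs (hS : IsNonneg S) : IsLargestExt S (friedrichs S hS) :=
  ⟨⟨le_friedrichs hS, h.isSelfAdjoint_friedrichs hS, quad_friedrichs_nonneg hS⟩,
    fun _ hB => formLE_friedrichs hS (h.isNonneg_friedrichs hS) hB.1⟩

theorem friedrichs_ne_krein (hS : IsNonneg S) : friedrichs S hS ≠ krein S hS := fun he =>
  h.eta_notMem_friedrichs hS (he ▸ h.eta_mem_krein hS)

theorem quad_eq_add (hS : IsNonneg S) {B : H →ₗ.[ℂ] H} (hB : B ≤ S†) (y : B.domain)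
    (g : (friedrichs S hS).domain) {a b : ℂ} (hg : HasCoord S η w g a 0)
    (hy : (y : H) = g + b • η) :
    quad B y = quad (friedrichs S hS) g + ((starRingEnd ℂ) b * a).re := by
  obtain ⟨x, hx⟩ := hg
  have e1 : friedrichs S hS g = S x + a • η := h.apply_eq (friedrichs_le_adjoint hS) hx
  rw [zero_smul, add_zero] at hx
  have e2 : B y = S x + a • η := h.apply_eq hB (b := b) (by rw [hy, hx])
  rw [quad, quad, e1, e2, hy, inner_add_left, Complex.add_re]
  congr 2
  rw [inner_smul_left, inner_add_right, h.inner_eta, inner_smul_right, h.inner_eta_eta, zero_add,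
    mul_one]

/-- The two forms differ by `Re (conj b * a)`. Subtracting elements of the domain of `S` from `y`
keeps `a` and `b` but makes the Friedrichs part arbitrarily small, so nonnegativity of `B` forces
this number to be nonnegative. -/
theorem quad_friedrichs_le (hS : IsNonneg S) {B : H →ₗ.[ℂ] H} (hSB : S ≤ B) (hB : B ≤ S†)
    (hn : ∀ y : B.domain, 0 ≤ quad B y) (y : B.domain)
    (g : (friedrichs S hS).domain) {b : ℂ} (hy : (y : H) = g + b • η) :
    quad (friedrichs S hS) g ≤ quad B y := by
  obtain ⟨a, x, hx⟩ := (h.mem_friedrichs hS).1 g.2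
  obtain ⟨v, hv, hq⟩ := exists_tendsto_quad_friedrichs_sub hS g
  have h1 : ∀ n, 0 ≤ quad (friedrichs S hS)
      (Submodule.inclusion (le_friedrichs hS).1 (v n) - g) + ((starRingEnd ℂ) b * a).re :=
    fun n => by
    have h2 := h.quad_eq_add hS hB (y - Submodule.inclusion hSB.1 (v n))
      (g - Submodule.inclusion (le_friedrichs hS).1 (v n)) (a := a) (b := b)
      ⟨x - v n, by
        simp only [AddSubgroupClass.coe_sub, Submodule.coe_inclusion, hx]
        module⟩
      (by
        simp only [AddSubgroupClass.coe_sub, Submodule.coe_inclusion, hy]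
        abel)
    rw [quad_sub_comm, ← h2]
    exact hn _
  have h3 := ge_of_tendsto' (hq.add_const _) h1
  rw [zero_add] at h3
  rw [h.quad_eq_add hS hB y g ⟨x, hx⟩ hy]
  linarith

/-- Split an approximating sequence for `B` as `g n + b n • η` and replace `g n` by a form-close `v
n` in the domain of `S`. The Krein form of `v n + b n • η` is that of `v n`, so no convergence of `b
n` is needed. -/
theorem isSmallestExt_krein (hS : IsNonneg S) : IsSmallestExt S (krein S hS) := by
  refine ⟨⟨le_krein hS, h.isSelfAdjoint_krein hS, h.quad_krein_nonneg hS⟩, ?_⟩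
  rintro B ⟨hSB, hsa, hn⟩ f c ⟨u, hu, hc, hq⟩
  have hB : B ≤ S† := by
    have := adjoint_le_adjoint hS.dense hSB
    rwa [LinearPMap.isSelfAdjoint_def.1 hsa] at this
  have hF := h.isNonneg_friedrichs hS
  have hex : ∀ n, ∃ (g : (friedrichs S hS).domain) (b : ℂ), (u n : H) = g + b • η := fun n => by
    obtain ⟨a, b, x, hx⟩ := h.mem_adjoint_domain.1 (hB.1 (u n).2)
    exact ⟨⟨x + a • w, (h.mem_friedrichs hS).2 ⟨a, x, by simp⟩⟩, b, hx⟩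
  choose g b hg using hex
  have hgc : FormCauchy (friedrichs S hS) g := by
    refine squeeze_zero (fun p => quad_friedrichs_nonneg hS _) (fun p => ?_) hc
    refine h.quad_friedrichs_le hS hSB hB hn _ _ (b := b p.1 - b p.2) ?_
    simp only [AddSubgroupClass.coe_sub, hg]
    module
  obtain ⟨c', hc'⟩ := hgc.exists_tendsto_quad hF
  obtain ⟨v, hv, hvq⟩ := exists_seq_tendsto_quad_friedrichs_sub hS g
  have hmem : ∀ n, (v n : H) + b n • η ∈ (krein S hS).domain := fun n =>
    (h.mem_krein hS).2 ⟨b n, v n, by simp⟩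
  have hvc : FormCauchy S v :=
    (formCauchy_inclusion (le_friedrichs hS)).1 (hgc.of_tendsto_quad_sub hF hvq)
  refine ⟨c', le_of_tendsto_of_tendsto' hc' hq fun n =>
    h.quad_friedrichs_le hS hSB hB hn _ _ (hg n), fun n => ⟨_, hmem n⟩, ?_, ?_, ?_⟩
  · have := hv.add hu
    rw [zero_add] at this
    refine this.congr fun n => ?_
    rw [hg]
    module
  · refine hvc.congr fun p => (h.quad_krein hS _ (b := b p.1 - b p.2) ?_).symm
    simp only [AddSubgroupClass.coe_sub]
    module
  · have := tendsto_quad_of_tendsto_quad_sub hF hc' hvq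
    refine this.congr fun n => ?_
    rw [quad_inclusion (le_friedrichs hS), h.quad_krein hS _ rfl]

end DefectBasis

end KInv

/-! ### The action of `K` on boundary values. -/

namespace KInv

variable {H : Type*} [NormedAddCommGroup H] [InnerProductSpace ℂ H]

theorem HasCoord.add {S : H →ₗ.[ℂ] H} {η w f g : H} {a b a' b' : ℂ} (hf : HasCoord S η w f a b)
    (hg : HasCoord S η w g a' b') : HasCoord S η w (f + g) (a + a') (b + b') := by
  obtain ⟨x, rfl⟩ := hf
  obtain ⟨y, rfl⟩ := hg
  refine ⟨x + y, ?_⟩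
  rw [Submodule.coe_add]
  module

theorem HasCoord.smul {S : H →ₗ.[ℂ] H} {η w f : H} {a b : ℂ} (t : ℂ)
    (hf : HasCoord S η w f a b) : HasCoord S η w (t • f) (t * a) (t * b) := by
  obtain ⟨x, rfl⟩ := hf
  refine ⟨t • x, ?_⟩
  rw [Submodule.coe_smul]
  module

theorem hasCoord_of_mem {S : H →ₗ.[ℂ] H} {η w f : H} (hf : f ∈ S.domain) :
    HasCoord S η w f 0 0 :=
  ⟨⟨f, hf⟩, by simp⟩

variable [CompleteSpace H]

theorem mem_graph_conj {K : H →L[ℂ] H} {T : H →ₗ.[ℂ] H} {f g : H} :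
    (f, g) ∈ (conj K T).graph ↔
      ∃ k, (K f, k) ∈ T.graph ∧ ContinuousLinearMap.adjoint K k = g := by
  simp only [LinearPMap.mem_graph_iff]
  constructor
  · rintro ⟨⟨y, hy⟩, rfl, rfl⟩
    exact ⟨T ⟨K y, hy⟩, ⟨⟨K y, hy⟩, rfl, rfl⟩, rfl⟩
  · rintro ⟨k, ⟨⟨y, hy⟩, h1, rfl⟩, rfl⟩
    change y = K f at h1
    subst h1
    exact ⟨⟨f, hy⟩, rfl, rfl⟩

theorem IsKInvariant.mem_graph_iff {K : H →L[ℂ] H} {T : H →ₗ.[ℂ] H} (hT : IsKInvariant K T)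
    {f g : H} : (f, g) ∈ T.graph ↔
      ∃ k, (K f, k) ∈ T.graph ∧ ContinuousLinearMap.adjoint K k = g := by
  rw [← mem_graph_conj, hT]

theorem IsKInvariant.exists_map {K : H →L[ℂ] H} {S : H →ₗ.[ℂ] H} (hS : IsKInvariant K S)
    (x : S.domain) : ∃ k : S.domain, (k : H) = K x ∧
      ContinuousLinearMap.adjoint K (S k) = S x := by
  obtain ⟨k, h1, h2⟩ := hS.mem_graph_iff.1 (S.mem_graph x)
  obtain ⟨z, hz, rfl⟩ := S.mem_graph_iff.1 h1
  exact ⟨z, hz, h2⟩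

theorem conj_mono (K : H →L[ℂ] H) {T R : H →ₗ.[ℂ] H} (h : T ≤ R) : conj K T ≤ conj K R :=
  ⟨fun _ hf => h.1 hf, fun x y hxy => by
    change ContinuousLinearMap.adjoint K (T ⟨K x, x.2⟩) =
      ContinuousLinearMap.adjoint K (R ⟨K y, y.2⟩)
    rw [h.2 (y := ⟨K y, y.2⟩) (congrArg K hxy)]⟩

/-- With `R = S†`, invariance of an extension becomes a condition on its domain, hence on boundary
values. -/
theorem IsKInvariant.restrict_iff {K : H →L[ℂ] H} {T R : H →ₗ.[ℂ] H} (hR : IsKInvariant K R)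
    (h : T ≤ R) : IsKInvariant K T ↔ ∀ f, K f ∈ T.domain ↔ f ∈ T.domain := by
  constructor
  · intro hT f
    change f ∈ (conj K T).domain ↔ _
    rw [hT]
  · intro hd
    have hc : conj K T ≤ R := by
      have := conj_mono K h
      rwa [show conj K R = R from hR] at this
    exact eq_of_le_of_le_of_domain_eq hc h (Submodule.ext hd)

theorem IsKInvariant.adjoint {K : H →L[ℂ] H} (hK : IsUnit K) {S : H →ₗ.[ℂ] H}
    (hd : Dense (S.domain : Set H)) (hS : IsKInvariant K S) : IsKInvariant K S† := by
  obtain ⟨⟨K, L, hKL, hLK⟩, rfl⟩ := hK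
  have hKL' : ∀ x, K (L x) = x := fun x => DFunLike.congr_fun hKL x
  have hLK' : ∀ x, L (K x) = x := fun x => DFunLike.congr_fun hLK x
  have hadj : ∀ x, ContinuousLinearMap.adjoint K (ContinuousLinearMap.adjoint L x) = x :=
    fun x => ext_inner_right ℂ fun y => by
      rw [ContinuousLinearMap.adjoint_inner_left, ContinuousLinearMap.adjoint_inner_left, hLK']
  have hfd : ∀ x : S.domain, ∃ k : S.domain, K k = x ∧
      ContinuousLinearMap.adjoint K (S x) = S k := fun x => by
    have : (L x, ContinuousLinearMap.adjoint K (S x)) ∈ S.graph :=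
      hS.mem_graph_iff.2 ⟨S x, by rw [hKL']; exact S.mem_graph x, rfl⟩
    obtain ⟨z, hz, hz'⟩ := S.mem_graph_iff.1 this
    exact ⟨z, by rw [hz]; exact hKL' _, hz'.symm⟩
  refine LinearPMap.eq_of_eq_graph (Submodule.ext fun p => ?_)
  obtain ⟨f, g⟩ := p
  change (f, g) ∈ (conj K S†).graph ↔ _
  rw [mem_graph_conj]
  constructor
  · rintro ⟨k, hk, rfl⟩
    rw [mem_graph_adjoint hd] at hk ⊢
    intro x
    obtain ⟨y, hy, hxy⟩ := hS.exists_map x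
    rw [ContinuousLinearMap.adjoint_inner_left, ← hy, hk, ← hxy,
      ContinuousLinearMap.adjoint_inner_right]
  · intro hfg'
    -- With `L = K⁻¹`, the only candidate for `S† (K f)` is `L* g`.
    refine ⟨ContinuousLinearMap.adjoint L g, ?_, hadj g⟩
    rw [mem_graph_adjoint hd] at hfg' ⊢
    intro x
    obtain ⟨y, hy, hxy⟩ := hfd x
    rw [ContinuousLinearMap.adjoint_inner_left, ← hy, hLK', hfg', ← hxy,
      ContinuousLinearMap.adjoint_inner_right]

/-- `K` preserves the form of `S`: `⟨K u, S K u⟩ = ⟨u, K* S K u⟩ = ⟨u, S u⟩`. -/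
theorem IsKInvariant.map_mem_friedrichs {K : H →L[ℂ] H} (hK : IsUnit K) {S : H →ₗ.[ℂ] H}
    (hS : IsKInvariant K S) (hN : IsNonneg S) {f : H} (hf : f ∈ (friedrichs S hN).domain) :
    K f ∈ (friedrichs S hN).domain := by
  obtain ⟨hf, u, hu, hc⟩ := hf
  choose v hv hv' using fun n => hS.exists_map (u n)
  refine ⟨(((IsKInvariant.adjoint hK hN.dense hS).restrict_iff le_rfl).1
    (IsKInvariant.adjoint hK hN.dense hS) f).2 hf, v, ?_, ?_⟩
  · simp only [hv]
    exact (K.continuous.tendsto f).comp hu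
  · refine hc.congr fun p => ?_
    rw [quad, quad, LinearPMap.map_sub, LinearPMap.map_sub, ← hv', ← hv', ← map_sub,
      ContinuousLinearMap.adjoint_inner_right]
    simp only [AddSubgroupClass.coe_sub, map_sub, hv]

namespace DefectBasis

variable {S : H →ₗ.[ℂ] H} {η w : H} (h : DefectBasis S η w)

include h

theorem exists_map_coord {K : H →L[ℂ] H} (hK : IsUnit K) (hKS : IsKInvariant K S)
    (hker : kernel S† = Submodule.span ℂ {η}) :
    ∃ ζ c : ℂ, K η = ζ • η ∧ (starRingEnd ℂ) ζ * c = 1 ∧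
      ∀ f a b, HasCoord S η w f a b → HasCoord S η w (K f) (c * a) (ζ * b) := by
  have hKA := IsKInvariant.adjoint hK h.pos.dense hKS
  have hinj : ∀ k, ContinuousLinearMap.adjoint K k = 0 → k = 0 := fun k hk => by
    obtain ⟨⟨K, L, hKL, hLK⟩, rfl⟩ := hK
    refine ext_inner_right ℂ fun y => ?_
    rw [← show K (L y) = y from DFunLike.congr_fun hKL y,
      ← ContinuousLinearMap.adjoint_inner_left, hk, inner_zero_left, inner_zero_left]
  have hη : (η, (0 : H)) ∈ S†.graph := by
    simpa using h.mem_graph 0 0 1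
  obtain ⟨k, hk, hk0⟩ := hKA.mem_graph_iff.1 hη
  rw [hinj k hk0] at hk
  have hKη : K η ∈ kernel S† := by
    obtain ⟨y, h1, h2⟩ := LinearPMap.mem_graph_iff _ |>.1 hk
    exact ⟨y, h2, h1⟩
  rw [hker, Submodule.mem_span_singleton] at hKη
  obtain ⟨ζ, hζ⟩ := hKη
  obtain ⟨c, x, hx⟩ := (h.mem_friedrichs h.pos.isNonneg).1
    (hKS.map_mem_friedrichs hK h.pos.isNonneg (h.w_mem_friedrichs h.pos.isNonneg))
  have hw : (w, η) ∈ S†.graph := by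
    simpa using h.mem_graph 0 1 0
  obtain ⟨l, hl, hl'⟩ := hKA.mem_graph_iff.1 hw
  have hg := h.mem_graph x c 0
  rw [← hx] at hg
  have e : l = S x + c • η := LinearPMap.mem_graph_snd_inj _ hl hg rfl
  refine ⟨ζ, c, hζ.symm, ?_, ?_⟩
  · have e1 : inner ℂ η (ContinuousLinearMap.adjoint K l) = (1 : ℂ) := by
      rw [hl', h.inner_eta_eta]
    rw [← e1, ContinuousLinearMap.adjoint_inner_right, e, ← hζ, inner_smul_left, inner_add_right,
      h.inner_eta, inner_smul_right, zero_add, h.inner_eta_eta, mul_one]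
  · rintro f a b ⟨y, rfl⟩
    have hy : K y ∈ S.domain :=
      ((hKS.restrict_iff le_rfl).1 hKS y).2 y.2
    have h1 : HasCoord S η w (K y) 0 0 := hasCoord_of_mem hy
    have h2 : HasCoord S η w (K w) c 0 := ⟨x, hx⟩
    have h3 : HasCoord S η w (K η) 0 ζ := ⟨0, by simp [hζ]⟩
    have := (h1.add (h2.smul a)).add (h3.smul b)
    simpa [mul_comm] using this

theorem isDissipative_coord {T : H →ₗ.[ℂ] H} (hT : IsDissipative T) (hle : T ≤ S†) {f : H}
    (hf : f ∈ T.domain) {a b : ℂ} (hc : HasCoord S η w f a b) :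
    0 ≤ ((starRingEnd ℂ) b * a).im := by
  obtain ⟨x, hx⟩ := hc
  have h1 := hT.2 ⟨f, hf⟩
  rw [h.apply_eq hle (f := ⟨f, hf⟩) hx] at h1
  change 0 ≤ (inner ℂ f (S x + a • η)).im at h1
  rwa [hx, h.im_inner] at h1

/-- The domain of a maximally dissipative extension is a line modulo the domain of `S`. -/
theorem exists_mem_domain_iff {T : H →ₗ.[ℂ] H} (hST : S ≤ T) (hT : IsMaxDissipative T) :
    ∃ a b : ℂ, (a ≠ 0 ∨ b ≠ 0) ∧
      ∀ f, f ∈ T.domain ↔ ∃ t : ℂ, HasCoord S η w f (t * a) (t * b) := by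
  have hN := h.pos.isNonneg
  have hle : T ≤ S† := hT.1.le_adjoint h.pos.toIsSymm hST
  obtain ⟨f, hf, a, b, hfab, hab⟩ : ∃ f ∈ T.domain, ∃ a b, HasCoord S η w f a b ∧
      (a ≠ 0 ∨ b ≠ 0) := by
    -- Otherwise `T` would be a restriction of the Friedrichs extension, hence equal to it by
    -- maximality, although `w` has boundary values `(1, 0)`.
    by_contra! hcon
    have h1 : T ≤ friedrichs S hN :=
      le_of_le_of_domain_le hle (friedrichs_le_adjoint hN) fun f hf => by
        obtain ⟨a, b, hab⟩ := h.mem_adjoint_domain.1 (hle.1 hf)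
        have := (hcon f hf a b hab).2
        rw [this] at hab
        exact (h.mem_friedrichs hN).2 ⟨a, hab⟩
    have h2 := hT.2 _ (isSymm_of_isSelfAdjoint (h.isSelfAdjoint_friedrichs hN)).isDissipative h1
    have h3 := h.w_mem_friedrichs hN
    rw [h2] at h3
    exact one_ne_zero (hcon w h3 1 0 ⟨0, by simp⟩).1
  refine ⟨a, b, hab, fun g => ⟨fun hg => ?_, ?_⟩⟩
  · obtain ⟨a', b', hg'⟩ := h.mem_adjoint_domain.1 (hle.1 hg)
    have hdet : a * b' = a' * b := by
      by_contra hne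
      have hΔ : a * b' - a' * b ≠ 0 := sub_ne_zero.2 hne
      -- Cramer's rule: independent boundary values would yield a vector of the domain with values
      -- `(-i, 1)`, where `Im (conj b * a) = -1`.
      have h1 := (hfab.smul ((-Complex.I * b' - a') / (a * b' - a' * b))).add
        (hg'.smul ((a + Complex.I * b) / (a * b' - a' * b)))
      have h2 := h.isDissipative_coord hT.1 hle
        (add_mem (Submodule.smul_mem _ _ hf) (Submodule.smul_mem _ _ hg)) h1
      have e1 : (-Complex.I * b' - a') / (a * b' - a' * b) * a +
          (a + Complex.I * b) / (a * b' - a' * b) * a' = -Complex.I := by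
        rw [div_mul_eq_mul_div, div_mul_eq_mul_div, ← add_div, div_eq_iff hΔ]
        ring
      have e2 : (-Complex.I * b' - a') / (a * b' - a' * b) * b +
          (a + Complex.I * b) / (a * b' - a' * b) * b' = 1 := by
        rw [div_mul_eq_mul_div, div_mul_eq_mul_div, ← add_div, div_eq_iff hΔ]
        ring
      rw [e1, e2] at h2
      norm_num at h2
    rcases hab with ha | hb
    · refine ⟨a' / a, ?_⟩
      rwa [div_mul_cancel₀ _ ha, div_mul_eq_mul_div, ← hdet, mul_div_cancel_left₀ _ ha]
    · refine ⟨b' / b, ?_⟩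
      rwa [div_mul_cancel₀ _ hb, div_mul_eq_mul_div, mul_comm b', hdet, mul_div_cancel_right₀ _ hb]
  · rintro ⟨t, y, hy⟩
    obtain ⟨x, hx⟩ := hfab
    have : g = t • f + ((y - t • x : S.domain) : H) := by
      rw [hy, hx, AddSubgroupClass.coe_sub, Submodule.coe_smul]
      module
    rw [this]
    exact add_mem (Submodule.smul_mem _ _ hf) (hST.1 (Subtype.prop _))

end DefectBasis

end KInv

/-! ### The dichotomy: which lines of boundary values are invariant. -/

theorem theoremt2p17 {H : Type*} [NormedAddCommGroup H] [InnerProductSpace ℂ H] [CompleteSpace H]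
    (S : H →ₗ.[ℂ] H) (hS : KInv.IsStrictlyPos S) (hclosed : S.IsClosed)
    (K : H →L[ℂ] H) (hK : IsUnit K) (hKS : KInv.IsKInvariant K S)
    (η : H) (hη : ‖η‖ = 1) (hker : KInv.kernel S† = Submodule.span ℂ {η}) :
    KInv.IsLargestExt S (KInv.friedrichs S hS.isNonneg) ∧
    KInv.IsSmallestExt S (KInv.krein S hS.isNonneg) ∧
    ∃ ζ : ℂ, K η = ζ • η ∧
      (‖ζ‖ ≠ 1 →
        KInv.friedrichs S hS.isNonneg ≠ KInv.krein S hS.isNonneg ∧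
        ∀ T : H →ₗ.[ℂ] H,
          (S ≤ T ∧ KInv.IsMaxDissipative T ∧ KInv.IsKInvariant K T) ↔
            (T = KInv.friedrichs S hS.isNonneg ∨ T = KInv.krein S hS.isNonneg)) ∧
      (‖ζ‖ = 1 →
        ∀ T : H →ₗ.[ℂ] H, S ≤ T → KInv.IsMaxDissipative T → KInv.IsKInvariant K T) := by
  obtain ⟨w, h⟩ := KInv.exists_defectBasis hS hclosed hη hker
  have hN := hS.isNonneg
  obtain ⟨ζ, c, hζ, hc, hmap⟩ := h.exists_map_coord hK hKS hker
  have hKA := KInv.IsKInvariant.adjoint hK hS.dense hKS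
  have hdom := (hKA.restrict_iff le_rfl).1 hKA
  have hζ0 : ζ ≠ 0 := by
    rintro rfl
    simp at hc
  have hc0 : c ≠ 0 := right_ne_zero_of_mul_eq_one hc
  have hback : ∀ f a b, KInv.HasCoord S η w (K f) a b →
      KInv.HasCoord S η w f (a / c) (b / ζ) := fun f a b hf => by
    obtain ⟨a', b', hf'⟩ := h.mem_adjoint_domain.1
      ((hdom f).1 (h.mem_adjoint_domain.2 ⟨a, b, hf⟩))
    obtain ⟨rfl, rfl⟩ := h.coord_unique hf (hmap _ _ _ hf')
    rwa [mul_div_cancel_left₀ _ hc0, mul_div_cancel_left₀ _ hζ0]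
  -- Compare `conj ζ * c = 1` with `conj ζ * ζ = ‖ζ‖ ^ 2`.
  have hnorm : c = ζ ↔ ‖ζ‖ = 1 := by
    have hsq : (starRingEnd ℂ) ζ * ζ = ((‖ζ‖ ^ 2 : ℝ) : ℂ) := by
      rw [mul_comm, Complex.mul_conj, Complex.normSq_eq_norm_sq]
    constructor
    · rintro rfl
      rw [hsq, Complex.ofReal_eq_one] at hc
      exact (pow_eq_one_iff_of_nonneg (norm_nonneg c) two_ne_zero).1 hc
    · intro h1
      rw [h1, one_pow, Complex.ofReal_one, ← hc] at hsq
      exact (mul_left_cancel₀ (by simpa using hζ0) hsq).symm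
  refine ⟨h.isLargestExt_friedrichs hN, h.isSmallestExt_krein hN, ζ, hζ, fun hne =>
    ⟨h.friedrichs_ne_krein hN, fun T => ⟨?_, ?_⟩⟩, fun h1 T hST hT => ?_⟩
  · rintro ⟨hST, hT, hKT⟩
    have hle := hT.1.le_adjoint hS.toIsSymm hST
    obtain ⟨a, b, hab, hiff⟩ := h.exists_mem_domain_iff hST hT
    by_cases hb : b = 0
    · left
      subst hb
      have ha : a ≠ 0 := by simpa using hab
      refine KInv.eq_of_le_of_le_of_domain_eq hle (KInv.friedrichs_le_adjoint hN)
        (Submodule.ext fun f => ?_)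
      rw [hiff, h.mem_friedrichs hN]
      simp only [mul_zero]
      exact ⟨fun ⟨t, ht⟩ => ⟨_, ht⟩, fun ⟨t, ht⟩ => ⟨t / a, by rwa [div_mul_cancel₀ _ ha]⟩⟩
    by_cases ha : a = 0
    · right
      subst ha
      refine KInv.eq_of_le_of_le_of_domain_eq hle (KInv.krein_le_adjoint hN)
        (Submodule.ext fun f => ?_)
      rw [hiff, h.mem_krein hN]
      simp only [mul_zero]
      exact ⟨fun ⟨t, ht⟩ => ⟨_, ht⟩, fun ⟨t, ht⟩ => ⟨t / b, by rwa [div_mul_cancel₀ _ hb]⟩⟩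
    -- On a line off both axes, invariance gives `(c * a, ζ * b) = (t * a, t * b)`, so `c = t = ζ`.
    · have hf : KInv.HasCoord S η w (a • w + b • η) a b := ⟨0, by simp⟩
      have hfT : a • w + b • η ∈ T.domain := (hiff _).2 ⟨1, by simpa using hf⟩
      obtain ⟨t, ht⟩ := (hiff _).1 (((hKA.restrict_iff hle).1 hKT _).2 hfT)
      obtain ⟨e1, e2⟩ := h.coord_unique (hmap _ _ _ hf) ht
      exact absurd (hnorm.1 ((mul_right_cancel₀ ha e1).trans (mul_right_cancel₀ hb e2).symm)) hne
  · rintro (rfl | rfl)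
    · refine ⟨KInv.le_friedrichs hN,
        KInv.isMaxDissipative_of_isSelfAdjoint (h.isSelfAdjoint_friedrichs hN),
        (hKA.restrict_iff (KInv.friedrichs_le_adjoint hN)).2 fun f => ?_⟩
      rw [h.mem_friedrichs hN, h.mem_friedrichs hN]
      exact ⟨fun ⟨a, ha⟩ => ⟨a / c, by simpa using hback _ _ _ ha⟩,
        fun ⟨a, ha⟩ => ⟨c * a, by simpa using hmap _ _ _ ha⟩⟩
    · refine ⟨KInv.le_krein hN,
        KInv.isMaxDissipative_of_isSelfAdjoint (h.isSelfAdjoint_krein hN),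
        (hKA.restrict_iff (KInv.krein_le_adjoint hN)).2 fun f => ?_⟩
      rw [h.mem_krein hN, h.mem_krein hN]
      exact ⟨fun ⟨a, ha⟩ => ⟨a / ζ, by simpa using hback _ _ _ ha⟩,
        fun ⟨a, ha⟩ => ⟨ζ * a, by simpa using hmap _ _ _ ha⟩⟩
  · have hle := hT.1.le_adjoint hS.toIsSymm hST
    obtain ⟨a, b, -, hiff⟩ := h.exists_mem_domain_iff hST hT
    -- Now `K` multiplies boundary values by a single nonzero scalar, which preserves every line.
    obtain rfl := hnorm.2 h1
    refine (hKA.restrict_iff hle).2 fun f => ?_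
    rw [hiff, hiff]
    exact ⟨fun ⟨t, ht⟩ => ⟨t / c, by simpa only [div_mul_eq_mul_div] using hback _ _ _ ht⟩,
      fun ⟨t, ht⟩ => ⟨c * t, by simpa only [mul_assoc] using hmap _ _ _ ht⟩⟩
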